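/- Let $n\ge 3$, let $\Omega\subset\mathbb R^n$ be a bounded open set (for instance a bounded domain with smooth boundary), let $2\le p<\frac{2(n-1)}{n-2}$, $p_0=\frac{2n}{2(n-1)-p(n-2)}$ and $\frac{2n}{n-2}\le m<\infty$. All function spaces are complex valued: $W_0^{1,r}(\Omega)$ is the closure of $D(\Omega)=C_0^\infty(\Omega;\mathbb C)$ in $W^{1,r}(\Omega)$, $W^{-1,s}(\Omega)$ is the dual of $W_0^{1,s'}(\Omega)$ with $\frac1s+\frac1{s'}=1$, and $L^{(2,m)}(\mathbb R_+;W_0^{1,2}(\Omega)):=L^{2}(\mathbb R_+;W_0^{1,2}(\Omega))\cap L^{m}(\mathbb R_+;W_0^{1,2}(\Omega))$ with the intersection norm. Let $q\in W^{-1,p_0}(\Omega)$. For $u\in W_0^{1,2}(\Omega)$, say that $F\in W^{-1,2}(\Omega)$ equals $q|u|^{p-2}u$ in the sense of distributions if for every $\varphi\in D(\Omega)$ the function $|u|^{p-2}u\,\varphi$ belongs to $W_0^{1,p_0'}(\Omega)$ and $\langle F,\varphi\rangle=\langle q,|u|^{p-2}u\,\varphi\rangle$. Then for every $u\in L^{(2,m)}(\mathbb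 R_+;W_0^{1,2}(\Omega))$ there is exactly one $\tilde f(u)\in L^2(\mathbb R_+;W^{-1,2}(\Omega))$ such that $\tilde f(u)(t)=q|u(t)|^{p-2}u(t)$ in the sense of distributions for almost every $t>0$, and the operator $$\tilde f: L^{(2,m)}(\mathbb R_+;W_0^{1,2}(\Omega))\longrightarrow L^2(\mathbb R_+;W^{-1,2}(\Omega)),\qquad \tilde f(u)=q|u|^{p-2}u,$$ is bounded: there is a continuous function $\mu:[0,\infty)\to[0,\infty)$ such that $\|\tilde f(u)\|_{L^2(\mathbb R_+;W^{-1,2}(\Omega))}\le\mu\big(\|u\|_{L^{(2,m)}(\mathbb R_+;W_0^{1,2}(\Omega))}\big)$ for all $u$. -/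

import Mathlib

open MeasureTheory TopologicalSpace Filter
open scoped ENNReal NNReal Distributions

noncomputable section

namespace SobolevProduct

/-- A smooth compactly supported function on `Ω` has finite `L^r(Ω)` norm. -/
theorem memLp_test {n : ℕ} {Ω : Opens (EuclideanSpace ℝ (Fin n))} (r : ℝ≥0∞)
    (φ : 𝓓(Ω, ℂ)) : MemLp (fun x => φ x) r (volume.restrict (Ω : Set _)) :=
  (φ.continuous.memLp_of_hasCompactSupport φ.hasCompactSupport).restrict _

/-- The gradient (as Fréchet derivative) of a test function has finite `L^r(Ω)` norm. -/
theorem memLp_fderiv_test {n : ℕ} {Ω : Opens (EuclideanSpace ℝ (Fin n))} (r : ℝ≥0∞)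
    (φ : 𝓓(Ω, ℂ)) :
    MemLp (fun x => fderiv ℝ (fun y => φ y) x) r (volume.restrict (Ω : Set _)) :=
  ((φ.contDiff.continuous_fderiv (by simp)).memLp_of_hasCompactSupport
    (φ.hasCompactSupport.fderiv ℝ)).restrict _

/-- The Banach space `L^r(Ω) × L^r(Ω)` (functions and gradients, complex valued), in which
`W₀^{1,r}(Ω)` is realized by identifying `u` with the pair `(u, ∇u)`. -/
abbrev FunGrad {n : ℕ} (Ω : Opens (EuclideanSpace ℝ (Fin n))) (r : ℝ≥0∞) : Type :=
  Lp ℂ r (volume.restrict (Ω : Set (EuclideanSpace ℝ (Fin n)))) ×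
    Lp (EuclideanSpace ℝ (Fin n) →L[ℝ] ℂ) r
      (volume.restrict (Ω : Set (EuclideanSpace ℝ (Fin n))))

/-- The linear map `φ ↦ (φ, ∇φ)` on complex test functions. -/
def testPair {n : ℕ} (Ω : Opens (EuclideanSpace ℝ (Fin n))) (r : ℝ≥0∞) [Fact (1 ≤ r)] :
    𝓓(Ω, ℂ) →ₗ[ℂ] FunGrad Ω r where
  toFun φ := ((memLp_test r φ).toLp _, (memLp_fderiv_test r φ).toLp _)
  map_add' φ ψ := by
    have hd (χ : 𝓓(Ω, ℂ)) : Differentiable ℝ (fun y => χ y) :=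
      χ.contDiff.differentiable (by simp)
    refine Prod.ext ?_ ?_
    · exact MemLp.toLp_add (memLp_test r φ) (memLp_test r ψ)
    · refine Eq.trans ?_ (MemLp.toLp_add (memLp_fderiv_test r φ) (memLp_fderiv_test r ψ))
      refine MemLp.toLp_congr (memLp_fderiv_test r (φ + ψ)) _ (Eventually.of_forall fun x => ?_)
      exact fderiv_add (hd φ x) (hd ψ x)
  map_smul' c φ := by
    have hd (χ : 𝓓(Ω, ℂ)) : Differentiable ℝ (fun y => χ y) :=
      χ.contDiff.differentiable (by simp)
    refine Prod.ext ?_ ?_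
    · exact MemLp.toLp_const_smul c (memLp_test r φ)
    · refine Eq.trans ?_ (MemLp.toLp_const_smul c (memLp_fderiv_test r φ))
      refine MemLp.toLp_congr (memLp_fderiv_test r (c • φ)) _ (Eventually.of_forall fun x => ?_)
      exact fderiv_const_smul (hd φ x) c

/-- The Sobolev space `W₀^{1,r}(Ω)` of complex valued functions: the closure of the test
functions for the norm `max (‖u‖_r) (‖∇u‖_r)` (equivalent to the usual `W^{1,r}` norm).
An element is the pair `(u, ∇u)`. -/
def W0 {n : ℕ} (Ω : Opens (EuclideanSpace ℝ (Fin n))) (r : ℝ≥0∞) [Fact (1 ≤ r)] :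
    Submodule ℂ (FunGrad Ω r) :=
  (LinearMap.range (testPair Ω r)).topologicalClosure

/-- The underlying function of an element of `W₀^{1,r}(Ω)`. -/
def W0.fn {n : ℕ} {Ω : Opens (EuclideanSpace ℝ (Fin n))} {r : ℝ≥0∞} [Fact (1 ≤ r)]
    (w : W0 Ω r) : EuclideanSpace ℝ (Fin n) → ℂ :=
  fun x => w.1.1 x

/-- A test function as an element of `W₀^{1,r}(Ω)`. -/
def W0.ofTest {n : ℕ} {Ω : Opens (EuclideanSpace ℝ (Fin n))} (r : ℝ≥0∞) [Fact (1 ≤ r)]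
    (φ : 𝓓(Ω, ℂ)) : W0 Ω r :=
  ⟨testPair Ω r φ, Submodule.le_topologicalClosure _ (LinearMap.mem_range_self _ φ)⟩

instance fact_one_le_conjExponent (s : ℝ≥0∞) : Fact (1 ≤ ENNReal.conjExponent s) :=
  ⟨le_self_add⟩

/-- The space `W^{-1,s}(Ω)`: the dual of `W₀^{1,s'}(Ω)`, `1/s + 1/s' = 1`, with the dual norm. -/
abbrev WNeg {n : ℕ} (Ω : Opens (EuclideanSpace ℝ (Fin n))) (s : ℝ≥0∞) : Type :=
  W0 Ω (ENNReal.conjExponent s) →L[ℂ] ℂ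

/-- `IsProduct q p u F`: the distribution `F ∈ W^{-1,2}(Ω)` is the product `q |u|^{p-2} u`, i.e.
for every test function `φ` the function `|u|^{p-2} u φ` belongs to `W₀^{1,s'}(Ω)` and
`⟨F, φ⟩ = ⟨q, |u|^{p-2} u φ⟩`. -/
def IsProduct {n : ℕ} {Ω : Opens (EuclideanSpace ℝ (Fin n))} {s : ℝ≥0∞} (q : WNeg Ω s) (p : ℝ)
    (u : W0 Ω 2) (F : WNeg Ω 2) : Prop :=
  ∀ φ : 𝓓(Ω, ℂ), ∃ w : W0 Ω (ENNReal.conjExponent s),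
    (∀ᵐ x ∂(volume.restrict (Ω : Set (EuclideanSpace ℝ (Fin n)))),
      W0.fn w x = ((‖W0.fn u x‖ ^ (p - 2) : ℝ) : ℂ) * W0.fn u x * φ x) ∧
    F (W0.ofTest _ φ) = q w

/-- Lebesgue measure on `R₊ = (0, ∞)`. -/
def volPos : Measure ℝ := volume.restrict (Set.Ioi 0)

/-- The space `L^{(2,m)}(R₊; X) = L^m(R₊; X) ∩ L²(R₊; X)` with the norm `max (‖u‖_2) (‖u‖_m)`:
pairs of an element of `L²` and an element of `L^m` that agree almost everywhere. -/
def L2m (X : Type*) [NormedAddCommGroup X] [NormedSpace ℂ X] (m : ℝ≥0∞) [Fact (1 ≤ m)] :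
    Submodule ℂ (Lp X 2 volPos × Lp X m volPos) where
  carrier := {u | ∀ᵐ t ∂volPos, u.1 t = u.2 t}
  zero_mem' := by
    filter_upwards [Lp.coeFn_zero X 2 volPos, Lp.coeFn_zero X m volPos] with t h1 h2
    exact h1.trans h2.symm
  add_mem' := by
    intro a b ha hb
    filter_upwards [ha, hb, Lp.coeFn_add a.1 b.1, Lp.coeFn_add a.2 b.2] with t h1 h2 h3 h4
    refine h3.trans (Eq.trans ?_ h4.symm)
    simp only [Pi.add_apply, h1, h2]
  smul_mem' := by
    intro c a ha
    filter_upwards [ha, Lp.coeFn_smul c a.1, Lp.coeFn_smul c a.2] with t h1 h2 h3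
    refine h2.trans (Eq.trans ?_ h3.symm)
    simp only [Pi.smul_apply, h1]

/-- The underlying function `R₊ → X` of an element of `L^{(2,m)}(R₊; X)`. -/
def L2m.fn {X : Type*} [NormedAddCommGroup X] [NormedSpace ℂ X] {m : ℝ≥0∞} [Fact (1 ≤ m)]
    (u : L2m X m) : ℝ → X :=
  fun t => u.1.1 t

/-- A (nonlinear) bounded operator: `‖f x‖ ≤ μ (‖x‖)` for some continuous `μ : R₊ → R₊`. -/
def IsBoundedOperator {X Y : Type*} [NormedAddCommGroup X] [NormedAddCommGroup Y]
    (f : X → Y) : Prop :=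
  ∃ μ : ℝ≥0 → ℝ≥0, Continuous μ ∧ ∀ x, ‖f x‖₊ ≤ μ ‖x‖₊

end SobolevProduct

end

open scoped Topology

noncomputable section

namespace SobolevProduct

/-! Put `α = p - 2`, `κ = (n-2)/(2n)` and `1/r = 1 - 1/p₀ = (p-1)κ + 1/2`. For `u, v ∈ W₀^{1,2}`,
the product `|u|^α u v` has gradient `|u|^α u ∇v + v D(|u|^α u)∇u`. By the Sobolev embedding into
`L^{1/κ}` and Hölder, `|u|^α u` lies in `L^a` with `1/a = (α+1)κ`, and `D(|u|^α u)∇u` lies in `L^s`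
with `1/s = ακ + 1/2`; both terms then lie in `L^r`. So multiplication by `|u|^α u` is an operator
`M u` from `W₀^{1,2}` to `W₀^{1,r}` of norm at most `K‖u‖^(p-1)`, and `q ∘ M u` is the required
element of `W^{-1,2}` (`exists_powMul_operator`, `exists_dual_comp`).

That `M u` takes values in `W₀^{1,r}` comes from regularization: `(|z|² + ε²)^(α/2) z` is smooth for
`ε ≠ 0`, so it sends test functions to test functions, and the operators depend continuously on `(ε,
u)` up to `ε = 0`. This continuity rests on a Vitali-type theorem for superposition operators
(`exists_continuous_superposition`), which uses that `Ω` has finite measure.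

In time, continuity of `u ↦ q ∘ M u` gives measurability, and `x^(p-1) ≤ x + x^(m/2)` gives the `L²`
bound (`exists_bounded_superposition`). Uniqueness follows from density of test functions and from
the fact that a `W₀^{1,r}` function determines its gradient (`W0.ext_fn`). -/

/-! ### The Sobolev embedding on `W₀^{1,2}(Ω)` -/

/-- Lower semicontinuity of the `L^β` norm: the estimate `‖f‖_β ≤ C ‖g‖_r` is closed in `L^r`. -/
theorem isClosed_setOf_eLpNorm_le {X E F : Type*} [MeasurableSpace X] {μ : Measure X}
    [NormedAddCommGroup E] [NormedAddCommGroup F] {r : ℝ≥0∞} [Fact (1 ≤ r)] (β : ℝ≥0∞)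
    (C : ℝ≥0) :
    IsClosed {w : Lp E r μ × Lp F r μ | eLpNorm w.1 β μ ≤ C * eLpNorm w.2 r μ} := by
  refine IsSeqClosed.isClosed fun w w₀ hw hlim => ?_
  have h1 : Tendsto (fun k => (w k).1) atTop (𝓝 w₀.1) := (continuous_fst.tendsto _).comp hlim
  have h2 : Tendsto (fun k => (w k).2) atTop (𝓝 w₀.2) := (continuous_snd.tendsto _).comp hlim
  obtain ⟨ns, hns, hae⟩ := (tendstoInMeasure_of_tendsto_Lp h1).exists_seq_tendsto_ae
  have h3 : Tendsto (fun k => eLpNorm (w (ns k)).2 r μ) atTop (𝓝 (eLpNorm w₀.2 r μ)) := by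
    have := (continuous_enorm.tendsto w₀.2).comp (h2.comp hns.tendsto_atTop)
    simpa only [Function.comp_def, Lp.enorm_def] using this
  -- Fatou's lemma along an a.e. convergent subsequence; no convergence in `L^β` is needed.
  calc eLpNorm w₀.1 β μ ≤ liminf (fun k => eLpNorm (w (ns k)).1 β μ) atTop :=
        Lp.eLpNorm_lim_le_liminf_eLpNorm (fun k => Lp.aestronglyMeasurable _) _ hae
    _ ≤ liminf (fun k => C * eLpNorm (w (ns k)).2 r μ) atTop :=
        liminf_le_liminf (Eventually.of_forall fun k => hw (ns k))
    _ = C * eLpNorm w₀.2 r μ :=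
        (ENNReal.Tendsto.const_mul h3 (Or.inr ENNReal.coe_ne_top)).liminf_eq

/-- An integral norm over `Ω` of a function supported in `Ω` is the norm over the whole space. -/
theorem eLpNorm_restrict_of_support_subset {n : ℕ} {Ω : Opens (EuclideanSpace ℝ (Fin n))}
    {F : Type*} [NormedAddCommGroup F] {f : EuclideanSpace ℝ (Fin n) → F}
    (hf : Function.support f ⊆ Ω) (r : ℝ≥0∞) :
    eLpNorm f r (volume.restrict (Ω : Set _)) = eLpNorm f r volume := by
  rw [← eLpNorm_indicator_eq_eLpNorm_restrict Ω.isOpen.measurableSet,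
    Set.indicator_eq_self.2 hf]

theorem support_fderiv_test_subset {n : ℕ} {Ω : Opens (EuclideanSpace ℝ (Fin n))}
    (φ : 𝓓(Ω, ℂ)) : Function.support (fderiv ℝ (fun y => φ y)) ⊆ Ω :=
  (support_fderiv_subset ℝ).trans φ.tsupport_subset

/-- The critical Sobolev exponent `2n/(n-2)`. -/
def sobolevExponent (n : ℕ) : ℝ≥0 := 2 * n / (n - 2 : ℝ).toNNReal

theorem coe_sobolevExponent {n : ℕ} (hn : 3 ≤ n) :
    (sobolevExponent n : ℝ) = 2 * n / (n - 2) := by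
  have : (3 : ℝ) ≤ n := by exact_mod_cast hn
  simp [sobolevExponent, Real.coe_toNNReal (n - 2 : ℝ) (by linarith)]

/-- The Gagliardo–Nirenberg–Sobolev inequality on `W₀^{1,2}(Ω)`. -/
theorem exists_eLpNorm_fn_le {n : ℕ} (hn : 3 ≤ n) (Ω : Opens (EuclideanSpace ℝ (Fin n))) :
    ∃ C : ℝ≥0, ∀ w : W0 Ω 2,
      eLpNorm w.1.1 (sobolevExponent n) (volume.restrict (Ω : Set _)) ≤
        C * eLpNorm w.1.2 2 (volume.restrict (Ω : Set _)) := by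
  have h3 : (3 : ℝ) ≤ n := by exact_mod_cast hn
  refine ⟨SNormLESNormFDerivOfEqConst ℂ
    (volume : Measure (EuclideanSpace ℝ (Fin n))) ((2 : ℝ≥0) : ℝ), fun w => ?_⟩
  -- The estimate is a closed condition, so test functions suffice; these extend by zero to the
  -- whole space.
  refine closure_minimal (s := (LinearMap.range (testPair Ω 2) : Set (FunGrad Ω 2))) ?_
    (isClosed_setOf_eLpNorm_le _ _) w.2
  rintro _ ⟨φ, rfl⟩
  simp only [Set.mem_ofPred_eq, testPair, LinearMap.coe_mk, AddHom.coe_mk]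
  rw [eLpNorm_congr_ae (MemLp.coeFn_toLp _), eLpNorm_congr_ae (MemLp.coeFn_toLp _),
    eLpNorm_restrict_of_support_subset ((subset_tsupport _).trans φ.tsupport_subset),
    eLpNorm_restrict_of_support_subset (support_fderiv_test_subset φ)]
  refine eLpNorm_le_eLpNorm_fderiv_of_eq (p := 2) volume (φ.contDiff.of_le (by simp))
    φ.hasCompactSupport (by norm_num) (by simp; omega) ?_
  rw [coe_sobolevExponent hn]
  simp only [finrank_euclideanSpace, Fintype.card_fin]
  push_cast
  have : (n : ℝ) - 2 ≠ 0 := by linarith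
  field_simp

/-- A linear map into `L^r` whose values are bounded in `L^β` defines a bounded operator into
`L^β`. -/
theorem exists_clm_coeFn_ae_eq {X V E : Type*} [MeasurableSpace X] {μ : Measure X}
    [NormedAddCommGroup V] [NormedSpace ℂ V] [NormedAddCommGroup E] [NormedSpace ℂ E]
    {r β : ℝ≥0∞} [Fact (1 ≤ r)] [Fact (1 ≤ β)] (L : V →ₗ[ℂ] Lp E r μ) (C : ℝ≥0)
    (hL : ∀ v, eLpNorm (L v) β μ ≤ C * ‖v‖ₑ) :
    ∃ J : V →L[ℂ] Lp E β μ, ∀ v, J v =ᵐ[μ] L v := by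
  have hmem (v : V) : MemLp (L v) β μ :=
    ⟨Lp.aestronglyMeasurable _, (hL v).trans_lt
      (ENNReal.mul_lt_top ENNReal.coe_lt_top enorm_lt_top)⟩
  let J : V →ₗ[ℂ] Lp E β μ :=
    { toFun := fun v => (hmem v).toLp _
      map_add' := fun v w => by
        rw [← MemLp.toLp_add]
        refine MemLp.toLp_congr _ _ ?_
        rw [map_add]
        exact Lp.coeFn_add _ _
      map_smul' := fun c w => by
        rw [RingHom.id_apply, ← MemLp.toLp_const_smul]
        refine MemLp.toLp_congr _ _ ?_
        rw [map_smul]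
        exact Lp.coeFn_smul _ _ }
  refine ⟨J.mkContinuous C fun v => ?_, fun v => MemLp.coeFn_toLp (hmem v)⟩
  calc ‖J v‖ = (eLpNorm (L v) β μ).toReal := Lp.norm_toLp _ (hmem v)
    _ ≤ (C * ‖v‖ₑ).toReal :=
        ENNReal.toReal_mono (ENNReal.mul_ne_top ENNReal.coe_ne_top enorm_ne_top) (hL v)
    _ = C * ‖v‖ := by rw [ENNReal.toReal_mul, ENNReal.coe_toReal, toReal_enorm]

/-- The Sobolev embedding `W₀^{1,2}(Ω) → L^{2n/(n-2)}(Ω)`. -/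
theorem exists_sobolevEmbedding {n : ℕ} (hn : 3 ≤ n) (Ω : Opens (EuclideanSpace ℝ (Fin n)))
    [Fact (1 ≤ (sobolevExponent n : ℝ≥0∞))] :
    ∃ J : W0 Ω 2 →L[ℂ] Lp ℂ (sobolevExponent n) (volume.restrict (Ω : Set _)),
      ∀ w, J w =ᵐ[volume.restrict (Ω : Set _)] W0.fn w := by
  obtain ⟨C, hC⟩ := exists_eLpNorm_fn_le hn Ω
  refine exists_clm_coeFn_ae_eq (r := 2)
    ((LinearMap.fst ℂ _ _).comp (W0 Ω 2).subtype) C fun w => (hC w).trans ?_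
  gcongr
  rw [← Lp.enorm_def, enorm_le_iff_norm_le]
  exact norm_snd_le w.1

/-! ### Superposition operators between Lebesgue spaces -/

section Superposition

variable {X E F : Type*} [MeasurableSpace X] {μ : Measure X}
  [NormedAddCommGroup E] [NormedAddCommGroup F]

/-- Hölder's inequality for a function dominated by `|w|^α ‖G‖`. -/
theorem eLpNorm_le_rpow_mul {α : ℝ} (hα : 0 ≤ α) {β s t : ℝ≥0∞}
    (hst : s⁻¹ = ENNReal.ofReal α * β⁻¹ + t⁻¹) {w : X → ℝ} {G : X → E} {h : X → F} (C : ℝ≥0)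
    (hw : AEStronglyMeasurable w μ) (hG : AEStronglyMeasurable G μ)
    (hh : ∀ᵐ x ∂μ, ‖h x‖ ≤ C * ‖w x‖ ^ α * ‖G x‖) :
    eLpNorm h s μ ≤ C * eLpNorm w β μ ^ α * eLpNorm G t μ := by
  -- For `α = 0` the Hölder exponent `β / α` used below degenerates, but then `s = t` and the bound
  -- is pointwise.
  rcases hα.eq_or_lt with rfl | hα
  · obtain rfl : s = t := by simpa using hst
    refine (eLpNorm_le_nnreal_smul_eLpNorm_of_ae_le_mul (g := G) (c := C) ?_ s).trans ?_
    · filter_upwards [hh] with x hx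
      rw [← NNReal.coe_le_coe]
      simpa using hx
    · simp [ENNReal.smul_def]
  · have hα0 : ENNReal.ofReal α ≠ 0 := by simpa using hα
    have hT : ENNReal.HolderTriple (β / ENNReal.ofReal α) t s := ⟨by
      rw [ENNReal.inv_div (Or.inl ENNReal.ofReal_ne_top) (Or.inl hα0), hst, div_eq_mul_inv]⟩
    calc eLpNorm h s μ
        ≤ C * eLpNorm (fun x => ‖w x‖ ^ α * ‖G x‖) s μ := by
          refine (eLpNorm_le_nnreal_smul_eLpNorm_of_ae_le_mul
            (g := fun x => ‖w x‖ ^ α * ‖G x‖) (c := C) ?_ s).trans (by simp [ENNReal.smul_def])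
          filter_upwards [hh] with x hx
          rw [← NNReal.coe_le_coe]
          simpa [abs_of_nonneg (Real.rpow_nonneg (abs_nonneg (w x)) α), mul_assoc] using hx
      _ ≤ C * (eLpNorm (fun x => ‖w x‖ ^ α) (β / ENNReal.ofReal α) μ * eLpNorm G t μ) := by
          gcongr
          refine (eLpNorm_le_eLpNorm_mul_eLpNorm_of_nnnorm (p := β / ENNReal.ofReal α) (q := t)
            ?_ hG.norm (fun a b : ℝ => a * b) 1 ?_).trans (by simp)
          · exact (hw.norm.aemeasurable.pow_const α).aestronglyMeasurable
          · exact Eventually.of_forall fun x => by simp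
      _ = C * eLpNorm w β μ ^ α * eLpNorm G t μ := by
          rw [eLpNorm_norm_rpow w hα, ENNReal.div_mul_cancel hα0 ENNReal.ofReal_ne_top, mul_assoc]

/-- A generalized dominated convergence theorem in `L^s`, where the dominating functions are
products of a bounded sequence in `L^β` and a convergent sequence in `L^t`. -/
theorem tendsto_eLpNorm_sub_of_dominated [IsFiniteMeasure μ] {α : ℝ} (hα : 0 ≤ α)
    {β s t : ℝ≥0∞} (hs : 1 ≤ s) (hs' : s ≠ ∞) (ht : 1 ≤ t) (ht' : t ≠ ∞)
    (hst : s⁻¹ = ENNReal.ofReal α * β⁻¹ + t⁻¹) {w : ℕ → X → ℝ} {G : ℕ → X → E} {G₀ : X → E}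
    {h : ℕ → X → F} {h₀ : X → F} (C K : ℝ≥0)
    (hw : ∀ k, AEStronglyMeasurable (w k) μ) (hwK : ∀ k, eLpNorm (w k) β μ ≤ K)
    (hG : ∀ k, MemLp (G k) t μ) (hG₀ : MemLp G₀ t μ)
    (hlim : Tendsto (fun k => eLpNorm (G k - G₀) t μ) atTop (𝓝 0))
    (hm : ∀ k, AEStronglyMeasurable (h k) μ) (hm₀ : MemLp h₀ s μ)
    (hh : ∀ k, ∀ᵐ x ∂μ, ‖h k x‖ ≤ C * ‖w k x‖ ^ α * ‖G k x‖)
    (hae : ∀ᵐ x ∂μ, Tendsto (fun k => h k x) atTop (𝓝 (h₀ x))) :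
    Tendsto (fun k => eLpNorm (h k - h₀) s μ) atTop (𝓝 0) := by
  -- Vitali's theorem: uniform integrability of `h k` is inherited from `G k` through Hölder on
  -- small sets, the factor `w k` being bounded by `K`.
  refine tendsto_Lp_finite_of_tendsto_ae hs hs' hm hm₀ (fun η hη => ?_) hae
  -- The `+ 1` keeps the divisor positive when `C * K ^ α = 0`.
  have hM : (0 : ℝ) < C * (K : ℝ) ^ α + 1 := by positivity
  obtain ⟨δ, hδ, H⟩ := unifIntegrable_of_tendsto_Lp ht ht' hG hG₀ hlim (div_pos hη hM)
  refine ⟨δ, hδ, fun k A hA hμA => ?_⟩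
  calc eLpNorm (A.indicator (h k)) s μ
      ≤ C * eLpNorm (w k) β μ ^ α * eLpNorm (A.indicator (G k)) t μ := by
        refine eLpNorm_le_rpow_mul hα hst C (hw k) ((hG k).1.indicator hA) ?_
        filter_upwards [hh k] with x hx
        by_cases hxA : x ∈ A
        · simpa [hxA] using hx
        · simp [hxA]
    _ ≤ C * (K : ℝ≥0∞) ^ α * ENNReal.ofReal (η / (C * (K : ℝ) ^ α + 1)) := by
        gcongr
        · exact hwK k
        · exact H k A hA hμA
    _ = ENNReal.ofReal (C * (K : ℝ) ^ α * (η / (C * (K : ℝ) ^ α + 1))) := by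
        rw [ENNReal.ofReal_mul (by positivity), ENNReal.ofReal_mul (by positivity),
          ENNReal.ofReal_coe_nnreal, ← ENNReal.ofReal_rpow_of_nonneg (by positivity) hα,
          ENNReal.ofReal_coe_nnreal]
    _ ≤ ENNReal.ofReal η := by
        refine ENNReal.ofReal_le_ofReal ?_
        rw [mul_div_assoc', div_le_iff₀ hM]
        nlinarith

/-- Continuity of the superposition operator `(ε, f, G) ↦ H(ε, f, G)` for a continuous function
`H` with `‖H(ε, z, y)‖ ≤ C (‖z‖ + |ε|)^α ‖y‖`. -/
theorem exists_continuous_superposition {D : Type*} [NormedAddCommGroup D] [IsFiniteMeasure μ]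
    {α : ℝ} (hα : 0 ≤ α) {β s t : ℝ≥0∞} [Fact (1 ≤ β)] [Fact (1 ≤ s)] [Fact (1 ≤ t)]
    (hs : s ≠ ∞) (ht : t ≠ ∞) (hst : s⁻¹ = ENNReal.ofReal α * β⁻¹ + t⁻¹)
    (H : ℝ × D × E → F) (hH : Continuous H) (C : ℝ≥0)
    (hC : ∀ ε z y, ‖H (ε, z, y)‖ ≤ C * (‖z‖ + |ε|) ^ α * ‖y‖) :
    ∃ N : ℝ × Lp D β μ × Lp E t μ → Lp F s μ, Continuous N ∧
      (∀ q, N q =ᵐ[μ] fun x => H (q.1, q.2.1 x, q.2.2 x)) ∧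
      ∀ f G, ‖N (0, f, G)‖ ≤ C * ‖f‖ ^ α * ‖G‖ := by
  have hmeas (q : ℝ × Lp D β μ × Lp E t μ) :
      AEStronglyMeasurable (fun x => H (q.1, q.2.1 x, q.2.2 x)) μ :=
    hH.comp_aestronglyMeasurable (aestronglyMeasurable_const.prodMk
      ((Lp.aestronglyMeasurable _).prodMk (Lp.aestronglyMeasurable _)))
  have hdom (q : ℝ × Lp D β μ × Lp E t μ) :
      ∀ᵐ x ∂μ, ‖H (q.1, q.2.1 x, q.2.2 x)‖ ≤
        C * ‖‖q.2.1 x‖ + |q.1|‖ ^ α * ‖q.2.2 x‖ :=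
    Eventually.of_forall fun x => by
      rw [Real.norm_of_nonneg (by positivity)]
      exact hC _ _ _
  have hwm (q : ℝ × Lp D β μ × Lp E t μ) :
      MemLp (fun x => ‖q.2.1 x‖ + |q.1|) β μ :=
    (Lp.memLp q.2.1).norm.add (memLp_const _)
  have hbound (q : ℝ × Lp D β μ × Lp E t μ) :
      eLpNorm (fun x => H (q.1, q.2.1 x, q.2.2 x)) s μ ≤
        C * eLpNorm (fun x => ‖q.2.1 x‖ + |q.1|) β μ ^ α * eLpNorm q.2.2 t μ :=
    eLpNorm_le_rpow_mul hα hst C (hwm q).1 (Lp.aestronglyMeasurable _) (hdom q)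
  have hmem (q : ℝ × Lp D β μ × Lp E t μ) :
      MemLp (fun x => H (q.1, q.2.1 x, q.2.2 x)) s μ :=
    ⟨hmeas q, (hbound q).trans_lt (ENNReal.mul_lt_top (ENNReal.mul_lt_top ENNReal.coe_lt_top
      (ENNReal.rpow_lt_top_of_nonneg hα (hwm q).2.ne)) (Lp.memLp q.2.2).2)⟩
  refine ⟨fun q => (hmem q).toLp _, ?_, fun q => MemLp.coeFn_toLp _, fun f G => ?_⟩
  · refine continuous_iff_seqContinuous.2 fun q q₀ hq => tendsto_of_subseq_tendsto fun ns hns => ?_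
    replace hq := hq.comp hns
    have hq1 : Tendsto (fun k => (q (ns k)).1) atTop (𝓝 q₀.1) := (continuous_fst.tendsto _).comp hq
    have hq2 : Tendsto (fun k => (q (ns k)).2.1) atTop (𝓝 q₀.2.1) :=
      ((continuous_fst.comp continuous_snd).tendsto _).comp hq
    have hq3 : Tendsto (fun k => (q (ns k)).2.2) atTop (𝓝 q₀.2.2) :=
      ((continuous_snd.comp continuous_snd).tendsto _).comp hq
    obtain ⟨ms, hms, hae1⟩ := (tendstoInMeasure_of_tendsto_Lp hq2).exists_seq_tendsto_ae
    obtain ⟨ls, hls, hae2⟩ := (tendstoInMeasure_of_tendsto_Lp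
      (hq3.comp hms.tendsto_atTop)).exists_seq_tendsto_ae
    refine ⟨ms ∘ ls, (Lp.tendsto_Lp_iff_tendsto_eLpNorm'' _ (fun k => hmem _) _ _).2 ?_⟩
    have hT := hms.tendsto_atTop.comp hls.tendsto_atTop
    obtain ⟨K₁, hK₁⟩ := ((hq2.comp hT).norm.bddAbove_range)
    obtain ⟨K₂, hK₂⟩ := ((hq1.comp hT).norm.bddAbove_range)
    have hK (k : ℕ) : eLpNorm (fun x => ‖(q (ns (ms (ls k)))).2.1 x‖ + |(q (ns (ms (ls k)))).1|)
        β μ ≤ (K₁.toNNReal + (eLpNorm (fun _ : X => K₂) β μ).toNNReal : ℝ≥0) := by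
      refine (eLpNorm_add_le (Lp.aestronglyMeasurable _).norm aestronglyMeasurable_const
        Fact.out).trans ?_
      rw [ENNReal.coe_add, ENNReal.coe_toNNReal (memLp_const K₂).2.ne]
      refine add_le_add ?_ (eLpNorm_mono fun x => ?_)
      · rw [eLpNorm_norm, ← Lp.enorm_def, ← ofReal_norm]
        exact ENNReal.ofReal_le_ofReal (hK₁ ⟨k, rfl⟩)
      · rw [Real.norm_eq_abs, Real.norm_eq_abs, abs_abs]
        exact (hK₂ ⟨k, rfl⟩).trans (le_abs_self _)
    refine tendsto_eLpNorm_sub_of_dominated hα Fact.out hs Fact.out ht hst C _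
      (fun k => (hwm _).1) hK (fun k => Lp.memLp _) (Lp.memLp q₀.2.2)
      ((Lp.tendsto_Lp_iff_tendsto_eLpNorm' _ _).1 (hq3.comp hT)) (fun k => hmeas _) (hmem q₀)
      (fun k => hdom _) ?_
    filter_upwards [hae1, hae2] with x h1 h2
    exact (hH.tendsto _).comp ((hq1.comp hT).prodMk_nhds
      ((h1.comp hls.tendsto_atTop).prodMk_nhds h2))
  · have h := hbound (0, f, G)
    simp only [abs_zero, add_zero, eLpNorm_norm] at h
    rw [Lp.norm_toLp, Lp.norm_def, Lp.norm_def, ENNReal.toReal_rpow, ← ENNReal.coe_toReal C,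
      ← ENNReal.toReal_mul, ← ENNReal.toReal_mul]
    exact ENNReal.toReal_mono (ENNReal.mul_ne_top (ENNReal.mul_ne_top ENNReal.coe_ne_top
      (ENNReal.rpow_ne_top_of_nonneg hα (Lp.memLp f).2.ne)) (Lp.memLp G).2.ne) h

end Superposition

/-! ### The regularized power and its real derivative -/

/-- The regularized power nonlinearity `(|z|² + ε²)^{α/2} z`. -/
def regPow (α ε : ℝ) (z : ℂ) : ℂ := (‖z‖ ^ 2 + ε ^ 2) ^ (α / 2) • z

/-- The derivative of `regPow α ε` at `z` for `ε ≠ 0`, and its limit for `ε = 0`. -/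
def regPowDeriv (α ε : ℝ) (z : ℂ) : ℂ →L[ℝ] ℂ :=
  (‖z‖ ^ 2 + ε ^ 2) ^ (α / 2) • ContinuousLinearMap.id ℝ ℂ +
    (α * (‖z‖ ^ 2 + ε ^ 2) ^ (α / 2 - 1)) • (innerSL ℝ z).smulRight z

theorem regPow_zero_left (α : ℝ) (z : ℂ) : regPow α 0 z = ((‖z‖ ^ α : ℝ) : ℂ) * z := by
  rw [regPow, zero_pow two_ne_zero, add_zero, ← Real.rpow_natCast, ← Real.rpow_mul (norm_nonneg z),
    Complex.real_smul]
  congr 4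
  push_cast
  ring

theorem rpow_norm_sq_add_le {α : ℝ} (hα : 0 ≤ α) (ε : ℝ) (z : ℂ) :
    (‖z‖ ^ 2 + ε ^ 2) ^ (α / 2) ≤ (‖z‖ + |ε|) ^ α := by
  calc (‖z‖ ^ 2 + ε ^ 2) ^ (α / 2) ≤ ((‖z‖ + |ε|) ^ 2) ^ (α / 2) := by
        gcongr
        nlinarith [sq_abs ε, mul_nonneg (norm_nonneg z) (abs_nonneg ε)]
    _ = (‖z‖ + |ε|) ^ α := by
        rw [← Real.rpow_natCast, ← Real.rpow_mul (by positivity)]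
        congr 1
        push_cast
        ring

/-- The rank-one map has norm `‖z‖²`, which is at most `‖z‖² + ε²` and so compensates the `-1` in
the exponent, even where that exponent is negative. -/
theorem norm_regPowDeriv_snd_le {α : ℝ} (hα : 0 ≤ α) (ε : ℝ) (z : ℂ) :
    ‖(α * (‖z‖ ^ 2 + ε ^ 2) ^ (α / 2 - 1)) • (innerSL ℝ z).smulRight z‖ ≤
      α * (‖z‖ ^ 2 + ε ^ 2) ^ (α / 2) := by
  rw [norm_smul, Real.norm_of_nonneg (by positivity), ContinuousLinearMap.norm_smulRight_apply,
    innerSL_apply_norm, mul_assoc]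
  gcongr
  rcases (by positivity : 0 ≤ ‖z‖ ^ 2 + ε ^ 2).eq_or_lt with h | h
  · have : ‖z‖ = 0 := by nlinarith [norm_nonneg z, sq_nonneg ε]
    rw [this]
    simp only [mul_zero]
    positivity
  · rw [Real.rpow_sub_one h.ne', div_mul_eq_mul_div, div_le_iff₀ h]
    gcongr
    nlinarith [sq_nonneg ε]

theorem norm_regPowDeriv_le {α : ℝ} (hα : 0 ≤ α) (ε : ℝ) (z : ℂ) :
    ‖regPowDeriv α ε z‖ ≤ (1 + α) * (‖z‖ + |ε|) ^ α := by
  refine (norm_add_le _ _).trans ?_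
  have h1 : ‖(‖z‖ ^ 2 + ε ^ 2) ^ (α / 2) • ContinuousLinearMap.id ℝ ℂ‖ ≤
      (‖z‖ ^ 2 + ε ^ 2) ^ (α / 2) := by
    rw [norm_smul, Real.norm_of_nonneg (by positivity)]
    exact mul_le_of_le_one_right (by positivity) ContinuousLinearMap.norm_id_le
  have h2 := rpow_norm_sq_add_le hα ε z
  nlinarith [norm_regPowDeriv_snd_le hα ε z]

theorem continuous_norm_sq_add_rpow {α : ℝ} (hα : 0 ≤ α) :
    Continuous fun q : ℝ × ℂ => (‖q.2‖ ^ 2 + q.1 ^ 2) ^ (α / 2) :=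
  Continuous.rpow_const (by fun_prop) fun _ => Or.inr (by positivity)

/-- Continuity has to include `ε = 0`, where the regularization is removed. Only the rank-one term
at the origin is delicate: for `α > 0` it is squeezed to zero by `norm_regPowDeriv_snd_le`, and for
`α = 0` it vanishes identically. -/
theorem continuous_regPowDeriv {α : ℝ} (hα : 0 ≤ α) :
    Continuous fun q : ℝ × ℂ => regPowDeriv α q.1 q.2 := by
  refine ((continuous_norm_sq_add_rpow hα).smul continuous_const).add ?_
  refine continuous_iff_continuousAt.2 fun q => ?_
  by_cases hq : ‖q.2‖ ^ 2 + q.1 ^ 2 = 0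
  · rcases hα.eq_or_lt with rfl | hα'
    · simpa using continuousAt_const
    have h0 : (α * (‖q.2‖ ^ 2 + q.1 ^ 2) ^ (α / 2 - 1)) • (innerSL ℝ q.2).smulRight q.2 = 0 := by
      have := norm_regPowDeriv_snd_le hα q.1 q.2
      rw [hq, Real.zero_rpow (half_pos hα').ne', mul_zero] at this
      rw [hq]
      exact norm_le_zero_iff.1 this
    rw [ContinuousAt, h0]
    refine squeeze_zero_norm (fun q => norm_regPowDeriv_snd_le hα q.1 q.2) ?_
    have := ((continuous_norm_sq_add_rpow hα).const_mul α).tendsto q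
    rwa [hq, Real.zero_rpow (half_pos hα').ne', mul_zero] at this
  · have h1 : ContinuousAt (fun q : ℝ × ℂ => ‖q.2‖ ^ 2 + q.1 ^ 2) q := by fun_prop
    have h2 : Continuous fun q : ℝ × ℂ => (innerSL ℝ q.2).smulRight q.2 := by fun_prop
    exact (continuousAt_const.mul (h1.rpow_const (Or.inl hq))).smul h2.continuousAt

theorem contDiff_regPow (α : ℝ) {ε : ℝ} (hε : ε ≠ 0) {k : WithTop ℕ∞} :
    ContDiff ℝ k (regPow α ε) := by
  refine ContDiff.smul (ContDiff.rpow_const_of_ne ?_ fun z => ?_) contDiff_id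
  · exact (contDiff_norm_sq ℝ).add contDiff_const
  · positivity

theorem hasFDerivAt_regPow (α : ℝ) {ε : ℝ} (hε : ε ≠ 0) (z : ℂ) :
    HasFDerivAt (regPow α ε) (regPowDeriv α ε z) z := by
  have h1 : HasFDerivAt (fun z : ℂ => ‖z‖ ^ 2 + ε ^ 2) (2 • innerSL ℝ z) z :=
    (hasStrictFDerivAt_norm_sq z).hasFDerivAt.add_const _
  have h2 := (h1.rpow_const (p := α / 2) (Or.inl (by positivity))).smul (hasFDerivAt_id z)
  refine h2.congr_fderiv ?_
  ext1 h
  simp [regPowDeriv]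
  ring

/-! ### Test functions: density, product and chain rules -/

theorem denseRange_ofTest {n : ℕ} (Ω : Opens (EuclideanSpace ℝ (Fin n))) (r : ℝ≥0∞)
    [Fact (1 ≤ r)] : DenseRange (W0.ofTest r : 𝓓(Ω, ℂ) → W0 Ω r) := by
  refine Subtype.dense_iff.2 fun w hw => ?_
  have : (((↑) : W0 Ω r → FunGrad Ω r) '' Set.range (W0.ofTest r : 𝓓(Ω, ℂ) → W0 Ω r)) =
      (LinearMap.range (testPair Ω r) : Set (FunGrad Ω r)) := by
    ext x
    simp [W0.ofTest]
  exact closure_mono this.ge hw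

theorem fn_ofTest {n : ℕ} {Ω : Opens (EuclideanSpace ℝ (Fin n))} (r : ℝ≥0∞) [Fact (1 ≤ r)]
    (φ : 𝓓(Ω, ℂ)) : W0.fn (W0.ofTest r φ) =ᵐ[volume.restrict (Ω : Set _)] fun x => φ x :=
  MemLp.coeFn_toLp (memLp_test r φ)

theorem grad_ofTest {n : ℕ} {Ω : Opens (EuclideanSpace ℝ (Fin n))} (r : ℝ≥0∞) [Fact (1 ≤ r)]
    (φ : 𝓓(Ω, ℂ)) : (W0.ofTest r φ).1.2 =ᵐ[volume.restrict (Ω : Set _)]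
      fun x => fderiv ℝ (fun y => φ y) x :=
  MemLp.coeFn_toLp (memLp_fderiv_test r φ)

/-- The test function `(|φ|² + ε²)^{α/2} φ ψ`. -/
def regPowMul {n : ℕ} {Ω : Opens (EuclideanSpace ℝ (Fin n))} (α : ℝ) {ε : ℝ} (hε : ε ≠ 0)
    (φ ψ : 𝓓(Ω, ℂ)) : 𝓓(Ω, ℂ) where
  toFun x := regPow α ε (φ x) * ψ x
  contDiff' := ((contDiff_regPow α hε).comp φ.contDiff).mul ψ.contDiff
  hasCompactSupport' := ψ.hasCompactSupport.mul_left
  tsupport_subset' := tsupport_mul_subset_right.trans ψ.tsupport_subset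

theorem fderiv_regPowMul {n : ℕ} {Ω : Opens (EuclideanSpace ℝ (Fin n))} (α : ℝ) {ε : ℝ}
    (hε : ε ≠ 0) (φ ψ : 𝓓(Ω, ℂ)) (x : EuclideanSpace ℝ (Fin n)) :
    fderiv ℝ (fun y => regPowMul α hε φ ψ y) x =
      regPow α ε (φ x) • fderiv ℝ (fun y => ψ y) x +
        ψ x • (regPowDeriv α ε (φ x)).comp (fderiv ℝ (fun y => φ y) x) := by
  have hd (χ : 𝓓(Ω, ℂ)) : HasFDerivAt (fun y => χ y) (fderiv ℝ (fun y => χ y) x) x :=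
    (χ.contDiff.differentiable (by simp) x).hasFDerivAt
  exact (((hasFDerivAt_regPow α hε (φ x)).comp x (hd φ)).mul (hd ψ)).fderiv

/-! ### Multiplication operators from `W₀^{1,2}(Ω)` to `W₀^{1,r}(Ω)` -/

/-- The operator `(a, b) ↦ (w ↦ (a w, a w' + b w''))` built from three bilinear maps. -/
theorem exists_product_rule_operator {A B X X' X'' Y Y' W : Type*}
    [NormedAddCommGroup A] [NormedSpace ℂ A] [NormedAddCommGroup B] [NormedSpace ℂ B]
    [NormedAddCommGroup X] [NormedSpace ℂ X] [NormedAddCommGroup X'] [NormedSpace ℂ X']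
    [NormedAddCommGroup X''] [NormedSpace ℂ X''] [NormedAddCommGroup Y] [NormedSpace ℂ Y]
    [NormedAddCommGroup Y'] [NormedSpace ℂ Y'] [NormedAddCommGroup W] [NormedSpace ℂ W]
    (T₁ : A →L[ℂ] X →L[ℂ] Y) (T₂ : A →L[ℂ] X' →L[ℂ] Y') (T₃ : B →L[ℂ] X'' →L[ℂ] Y')
    (i : W →L[ℂ] X) (i' : W →L[ℂ] X') (j : W →L[ℂ] X'') :
    ∃ T : A × B →L[ℂ] W →L[ℂ] Y × Y', (∃ K : ℝ≥0, ∀ a b, ‖T (a, b)‖ ≤ K * (‖a‖ + ‖b‖)) ∧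
      ∀ a b w, T (a, b) w = (T₁ a (i w), T₂ a (i' w) + T₃ b (j w)) := by
  let S₁ : A →L[ℂ] W →L[ℂ] Y := ((ContinuousLinearMap.compL ℂ W X Y).flip i).comp T₁
  let S₂ : A →L[ℂ] W →L[ℂ] Y' := ((ContinuousLinearMap.compL ℂ W X' Y').flip i').comp T₂
  let S₃ : B →L[ℂ] W →L[ℂ] Y' := ((ContinuousLinearMap.compL ℂ W X'' Y').flip j).comp T₃
  let T := (ContinuousLinearMap.compL ℂ W Y (Y × Y') (.inl ℂ Y Y')).comp
      (S₁.comp (.fst ℂ A B)) +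
    (ContinuousLinearMap.compL ℂ W Y' (Y × Y') (.inr ℂ Y Y')).comp
      (S₂.comp (.fst ℂ A B) + S₃.comp (.snd ℂ A B))
  refine ⟨T, ⟨‖T‖₊, fun a b => (T.le_opNorm _).trans ?_⟩, fun a b w => ?_⟩
  · gcongr
    exacts [le_rfl, max_le_add_of_nonneg (norm_nonneg _) (norm_nonneg _)]
  · simp [T, S₁, S₂, S₃]

/-- For a space `W` of functions with a gradient `i'` and embeddings `i` and `J` into `L²` and
`L^β`, the operator `v ↦ (g(u) v, ∇(g(u) v))`, `g = regPow α ε`, given by the product and chain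
rules, depends continuously on `(ε, u)`. -/
theorem exists_regPow_operator {X D W : Type*} [MeasurableSpace X] {μ : Measure X}
    [IsFiniteMeasure μ] [NormedAddCommGroup D] [NormedSpace ℝ D] [NormedAddCommGroup W]
    [NormedSpace ℂ W] {α : ℝ} (hα : 0 ≤ α) {β a s r : ℝ≥0∞} [Fact (1 ≤ β)] [Fact (1 ≤ a)]
    [Fact (1 ≤ s)] [Fact (1 ≤ r)] (hβ : β ≠ ∞) (ha : a ≠ ∞) (hs : s ≠ ∞)
    (haβ : a⁻¹ = ENNReal.ofReal α * β⁻¹ + β⁻¹) (hsβ : s⁻¹ = ENNReal.ofReal α * β⁻¹ + 2⁻¹)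
    [ENNReal.HolderTriple a 2 r] [ENNReal.HolderTriple s β r]
    (i : W →L[ℂ] Lp ℂ 2 μ) (i' : W →L[ℂ] Lp (D →L[ℝ] ℂ) 2 μ) (J : W →L[ℂ] Lp ℂ β μ) :
    ∃ M : ℝ × W → W →L[ℂ] Lp ℂ r μ × Lp (D →L[ℝ] ℂ) r μ, Continuous M ∧
      (∃ K : ℝ≥0, ∀ u, ‖M (0, u)‖ ≤ K * (‖u‖ ^ α * ‖u‖)) ∧
      (∀ ε u v, (M (ε, u) v).1 =ᵐ[μ] fun x => regPow α ε (J u x) * i v x) ∧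
      ∀ ε u v, (M (ε, u) v).2 =ᵐ[μ] fun x => regPow α ε (J u x) • i' v x +
        J v x • (regPowDeriv α ε (J u x)).comp (i' u x) := by
  -- `N₁` is the coefficient `g(u)` in `L^a`; the embedded `u` serves both as base of the power and
  -- as linear factor.
  obtain ⟨N₁, hN₁c, hN₁, hN₁b⟩ := exists_continuous_superposition (μ := μ) (s := a)
    (β := β) (t := β) hα ha hβ haβ
    (fun q : ℝ × ℂ × ℂ => (‖q.2.1‖ ^ 2 + q.1 ^ 2) ^ (α / 2) • q.2.2)
    (((continuous_norm_sq_add_rpow hα).comp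
      (continuous_fst.prodMk (continuous_fst.comp continuous_snd))).smul
      (continuous_snd.comp continuous_snd)) 1 (fun ε z y => by
        rw [norm_smul, Real.norm_of_nonneg (by positivity), NNReal.coe_one, one_mul]
        gcongr
        exact rpow_norm_sq_add_le hα ε z)
  -- `N₂` is `Dg(u)∇u` in `L^s`, with `α` factors from `L^β` and the gradient from `L²`.
  obtain ⟨N₂, hN₂c, hN₂, hN₂b⟩ := exists_continuous_superposition (μ := μ) (s := s)
    (β := β) (t := 2) hα hs ENNReal.ofNat_ne_top hsβ
    (fun q : ℝ × ℂ × (D →L[ℝ] ℂ) => (regPowDeriv α q.1 q.2.1).comp q.2.2)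
    (((continuous_regPowDeriv hα).comp
      (continuous_fst.prodMk (continuous_fst.comp continuous_snd))).clm_comp
      (continuous_snd.comp continuous_snd)) (1 + α.toNNReal) (fun ε z y => by
        refine (ContinuousLinearMap.opNorm_comp_le _ _).trans ?_
        rw [NNReal.coe_add, NNReal.coe_one, Real.coe_toNNReal _ hα]
        gcongr
        exact norm_regPowDeriv_le hα ε z)
  let B₁ : ℂ →L[ℂ] ℂ →L[ℂ] ℂ := ContinuousLinearMap.lsmul ℂ ℂ
  let B₂ : ℂ →L[ℂ] (D →L[ℝ] ℂ) →L[ℂ] (D →L[ℝ] ℂ) := ContinuousLinearMap.lsmul ℂ ℂ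
  obtain ⟨T, ⟨K, hK⟩, hT⟩ := exists_product_rule_operator (B₁.holderL μ a 2 r)
    (B₂.holderL μ a 2 r) (B₂.flip.holderL μ s β r) i i' J
  refine ⟨fun q => T (N₁ (q.1, J q.2, J q.2), N₂ (q.1, J q.2, i' q.2)), ?_, ?_,
    fun ε u v => ?_, fun ε u v => ?_⟩
  · have h1 : Continuous fun q : ℝ × W => J q.2 := J.continuous.comp continuous_snd
    have h2 : Continuous fun q : ℝ × W => i' q.2 := i'.continuous.comp continuous_snd
    exact T.continuous.comp ((hN₁c.comp (continuous_fst.prodMk (h1.prodMk h1))).prodMk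
      (hN₂c.comp (continuous_fst.prodMk (h1.prodMk h2))))
  · refine ⟨K * (‖J‖₊ ^ α * ‖J‖₊ + (1 + α.toNNReal) * ‖J‖₊ ^ α * ‖i'‖₊), fun u => ?_⟩
    have hJu : ‖J u‖ ^ α ≤ ‖J‖ ^ α * ‖u‖ ^ α := by
      rw [← Real.mul_rpow (norm_nonneg J) (norm_nonneg u)]
      exact Real.rpow_le_rpow (norm_nonneg _) (J.le_opNorm u) hα
    have h1 : ‖N₁ (0, J u, J u)‖ ≤ ‖J‖ ^ α * ‖J‖ * (‖u‖ ^ α * ‖u‖) :=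
      calc ‖N₁ (0, J u, J u)‖ ≤ ‖J u‖ ^ α * ‖J u‖ := by simpa using hN₁b (J u) (J u)
        _ ≤ (‖J‖ ^ α * ‖u‖ ^ α) * (‖J‖ * ‖u‖) :=
            mul_le_mul hJu (J.le_opNorm u) (norm_nonneg _) (by positivity)
        _ = _ := by ring
    have h2 : ‖N₂ (0, J u, i' u)‖ ≤ (1 + α) * ‖J‖ ^ α * ‖i'‖ * (‖u‖ ^ α * ‖u‖) :=
      calc ‖N₂ (0, J u, i' u)‖ ≤ (1 + α) * ‖J u‖ ^ α * ‖i' u‖ := by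
            simpa [Real.coe_toNNReal _ hα] using hN₂b (J u) (i' u)
        _ ≤ (1 + α) * (‖J‖ ^ α * ‖u‖ ^ α) * (‖i'‖ * ‖u‖) :=
            mul_le_mul (mul_le_mul_of_nonneg_left hJu (by positivity)) (i'.le_opNorm u)
              (norm_nonneg _) (by positivity)
        _ = _ := by ring
    calc _ ≤ K * (‖N₁ (0, J u, J u)‖ + ‖N₂ (0, J u, i' u)‖) := hK _ _
      _ ≤ K * (‖J‖ ^ α * ‖J‖ * (‖u‖ ^ α * ‖u‖) +
          (1 + α) * ‖J‖ ^ α * ‖i'‖ * (‖u‖ ^ α * ‖u‖)) :=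
          mul_le_mul_of_nonneg_left (add_le_add h1 h2) K.coe_nonneg
      _ = _ := by
          push_cast
          rw [Real.coe_toNNReal _ hα]
          ring
  · have h : (T (N₁ (ε, J u, J u), N₂ (ε, J u, i' u)) v).1 =
        B₁.holder r (N₁ (ε, J u, J u)) (i v) := congrArg Prod.fst (hT _ _ v)
    dsimp only
    rw [h]
    filter_upwards [B₁.coeFn_holder (r := r) (N₁ (ε, J u, J u)) (i v),
      hN₁ (ε, J u, J u)] with x h1 h2
    rw [h1, h2]
    rfl
  · have h : (T (N₁ (ε, J u, J u), N₂ (ε, J u, i' u)) v).2 =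
        B₂.holder r (N₁ (ε, J u, J u)) (i' v) + B₂.flip.holder r (N₂ (ε, J u, i' u)) (J v) :=
      congrArg Prod.snd (hT _ _ v)
    dsimp only
    rw [h]
    filter_upwards [Lp.coeFn_add (B₂.holder r (N₁ (ε, J u, J u)) (i' v))
        (B₂.flip.holder r (N₂ (ε, J u, i' u)) (J v)),
      B₂.coeFn_holder (r := r) (N₁ (ε, J u, J u)) (i' v),
      B₂.flip.coeFn_holder (r := r) (N₂ (ε, J u, i' u)) (J v),
      hN₁ (ε, J u, J u), hN₂ (ε, J u, i' u)] with x h1 h2 h3 h4 h5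
    rw [h1, Pi.add_apply, h2, h3, h4, h5]
    rfl

/-- The inclusion of `W₀^{1,r}(Ω)` into `L^r(Ω)`. -/
def W0.fnL {n : ℕ} (Ω : Opens (EuclideanSpace ℝ (Fin n))) (r : ℝ≥0∞) [Fact (1 ≤ r)] :
    W0 Ω r →L[ℂ] Lp ℂ r (volume.restrict (Ω : Set (EuclideanSpace ℝ (Fin n)))) :=
  (ContinuousLinearMap.fst ℂ _ _).comp (W0 Ω r).subtypeL

/-- The weak gradient on `W₀^{1,r}(Ω)`. -/
def W0.gradL {n : ℕ} (Ω : Opens (EuclideanSpace ℝ (Fin n))) (r : ℝ≥0∞) [Fact (1 ≤ r)] :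
    W0 Ω r →L[ℂ] Lp (EuclideanSpace ℝ (Fin n) →L[ℝ] ℂ) r
      (volume.restrict (Ω : Set (EuclideanSpace ℝ (Fin n)))) :=
  (ContinuousLinearMap.snd ℂ _ _).comp (W0 Ω r).subtypeL

theorem gradL_ofTest {n : ℕ} {Ω : Opens (EuclideanSpace ℝ (Fin n))} (r : ℝ≥0∞) [Fact (1 ≤ r)]
    (φ : 𝓓(Ω, ℂ)) : W0.gradL Ω r (W0.ofTest r φ) =ᵐ[volume.restrict (Ω : Set _)]
      fun x => fderiv ℝ (fun y => φ y) x :=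
  grad_ofTest r φ

/-- An operator-valued map, continuous in `(ε, u)`, which for `ε ≠ 0` maps test functions to test
functions has all its values in `W₀^{1,r}(Ω)`. -/
theorem mem_W0_of_forall_test {n : ℕ} {Ω : Opens (EuclideanSpace ℝ (Fin n))} {t r : ℝ≥0∞}
    [Fact (1 ≤ t)] [Fact (1 ≤ r)] {M : ℝ × W0 Ω t → W0 Ω t →L[ℂ] FunGrad Ω r}
    (hM : Continuous M)
    (h : ∀ ε ≠ 0, ∀ φ ψ, M (ε, W0.ofTest t φ) (W0.ofTest t ψ) ∈ W0 Ω r) (ε : ℝ) (u v : W0 Ω t) :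
    M (ε, u) v ∈ W0 Ω r := by
  have hclosed : IsClosed {q : (ℝ × W0 Ω t) × W0 Ω t | M q.1 q.2 ∈ W0 Ω r} :=
    IsClosed.preimage (f := fun q : (ℝ × W0 Ω t) × W0 Ω t => M q.1 q.2)
      ((hM.comp continuous_fst).clm_apply continuous_snd)
      (Submodule.isClosed_topologicalClosure _)
  -- Nonzero `ε` are dense in `ℝ`, so the closed condition reaches `ε = 0`.
  have hdense : Dense ((({0}ᶜ : Set ℝ) ×ˢ Set.range (W0.ofTest t : 𝓓(Ω, ℂ) → W0 Ω t)) ×ˢ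
      Set.range (W0.ofTest t : 𝓓(Ω, ℂ) → W0 Ω t)) :=
    ((dense_compl_singleton 0).prod (denseRange_ofTest Ω t)).prod (denseRange_ofTest Ω t)
  refine hclosed.closure_subset_iff.2 ?_ (hdense.closure_eq ▸ Set.mem_univ ((ε, u), v))
  rintro ⟨⟨ε, _⟩, _⟩ ⟨⟨hε, ⟨φ, rfl⟩⟩, ⟨ψ, rfl⟩⟩
  exact h ε hε φ ψ

/-- The product and chain rules for `regPowMul`, in `W₀^{1,r}(Ω)`. -/
theorem eq_ofTest_regPowMul {n : ℕ} {Ω : Opens (EuclideanSpace ℝ (Fin n))} {r : ℝ≥0∞}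
    [Fact (1 ≤ r)] (α : ℝ) {ε : ℝ} (hε : ε ≠ 0) (φ ψ : 𝓓(Ω, ℂ)) (w : FunGrad Ω r)
    (h₁ : w.1 =ᵐ[volume.restrict (Ω : Set _)] fun x => regPow α ε (φ x) * ψ x)
    (h₂ : w.2 =ᵐ[volume.restrict (Ω : Set _)] fun x =>
      regPow α ε (φ x) • fderiv ℝ (fun y => ψ y) x +
        ψ x • (regPowDeriv α ε (φ x)).comp (fderiv ℝ (fun y => φ y) x)) :
    w = (W0.ofTest r (regPowMul α hε φ ψ)).1 := by
  refine Prod.ext (Lp.ext ?_) (Lp.ext ?_)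
  · exact h₁.trans (fn_ofTest r (regPowMul α hε φ ψ)).symm
  · filter_upwards [h₂, grad_ofTest r (regPowMul α hε φ ψ)] with x h1 h2
    rw [h1, h2, fderiv_regPowMul]

set_option maxHeartbeats 800000 in
/-- `exists_regPow_operator` on `W₀^{1,2}(Ω)`, where `L^β` is given by the Sobolev embedding. -/
theorem exists_regPow_operator_W0 {n : ℕ} (hn : 3 ≤ n) (Ω : Opens (EuclideanSpace ℝ (Fin n)))
    (hΩ : Bornology.IsBounded (Ω : Set (EuclideanSpace ℝ (Fin n)))) {α : ℝ} (hα : 0 ≤ α)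
    (a s r : ℝ≥0∞) [Fact (1 ≤ (sobolevExponent n : ℝ≥0∞))] [Fact (1 ≤ a)] [Fact (1 ≤ s)]
    [Fact (1 ≤ r)] (ha : a ≠ ∞) (hs : s ≠ ∞)
    (haβ : a⁻¹ = ENNReal.ofReal α * (sobolevExponent n : ℝ≥0∞)⁻¹ + (sobolevExponent n : ℝ≥0∞)⁻¹)
    (hsβ : s⁻¹ = ENNReal.ofReal α * (sobolevExponent n : ℝ≥0∞)⁻¹ + 2⁻¹)
    [ENNReal.HolderTriple a 2 r] [ENNReal.HolderTriple s (sobolevExponent n) r] :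
    ∃ M : ℝ × W0 Ω 2 → W0 Ω 2 →L[ℂ] FunGrad Ω r, Continuous M ∧
      (∃ K : ℝ≥0, ∀ u, ‖M (0, u)‖ ≤ K * (‖u‖ ^ α * ‖u‖)) ∧
      (∀ ε u v, (M (ε, u) v).1 =ᵐ[volume.restrict (Ω : Set _)]
        fun x => regPow α ε (W0.fn u x) * W0.fn v x) ∧
      ∀ ε u v, (M (ε, u) v).2 =ᵐ[volume.restrict (Ω : Set _)] fun x =>
        regPow α ε (W0.fn u x) • W0.gradL Ω 2 v x +
          W0.fn v x • (regPowDeriv α ε (W0.fn u x)).comp (W0.gradL Ω 2 u x) := by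
  have : IsFiniteMeasure (volume.restrict (Ω : Set (EuclideanSpace ℝ (Fin n)))) :=
    isFiniteMeasure_restrict.2 hΩ.measure_lt_top.ne
  obtain ⟨J, hJ⟩ := exists_sobolevEmbedding hn Ω
  obtain ⟨M, hMc, hMb, hM1, hM2⟩ := exists_regPow_operator (r := r) hα ENNReal.coe_ne_top ha hs
    haβ hsβ (W0.fnL Ω 2) (W0.gradL Ω 2) J
  refine ⟨M, hMc, hMb, fun ε u v => ?_, fun ε u v => ?_⟩
  · filter_upwards [hM1 ε u v, hJ u] with x h1 h2
    rw [h1, h2]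
    rfl
  · filter_upwards [hM2 ε u v, hJ u, hJ v] with x h1 h2 h3
    rw [h1, h2, h3]

set_option maxHeartbeats 400000 in
/-- Multiplication by `|u|^α u` as an operator from `W₀^{1,2}(Ω)` into `W₀^{1,r}(Ω)` depends
continuously on `u ∈ W₀^{1,2}(Ω)`, with a bound of order `α + 1`. -/
theorem exists_powMul_operator {n : ℕ} (hn : 3 ≤ n) (Ω : Opens (EuclideanSpace ℝ (Fin n)))
    (hΩ : Bornology.IsBounded (Ω : Set (EuclideanSpace ℝ (Fin n)))) {α : ℝ} (hα : 0 ≤ α)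
    (a s r : ℝ≥0∞) [Fact (1 ≤ (sobolevExponent n : ℝ≥0∞))] [Fact (1 ≤ a)] [Fact (1 ≤ s)]
    [Fact (1 ≤ r)] (ha : a ≠ ∞) (hs : s ≠ ∞)
    (haβ : a⁻¹ = ENNReal.ofReal α * (sobolevExponent n : ℝ≥0∞)⁻¹ + (sobolevExponent n : ℝ≥0∞)⁻¹)
    (hsβ : s⁻¹ = ENNReal.ofReal α * (sobolevExponent n : ℝ≥0∞)⁻¹ + 2⁻¹)
    [ENNReal.HolderTriple a 2 r] [ENNReal.HolderTriple s (sobolevExponent n) r] :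
    ∃ M : W0 Ω 2 → W0 Ω 2 →L[ℂ] FunGrad Ω r, Continuous M ∧
      (∃ K : ℝ≥0, ∀ u, ‖M u‖ ≤ K * (‖u‖ ^ α * ‖u‖)) ∧
      ∀ u v, M u v ∈ W0 Ω r ∧ (M u v).1 =ᵐ[volume.restrict (Ω : Set _)]
        fun x => ((‖W0.fn u x‖ ^ α : ℝ) : ℂ) * W0.fn u x * W0.fn v x := by
  obtain ⟨M, hMc, hMb, hM1, hM2⟩ :=
    exists_regPow_operator_W0 hn Ω hΩ hα a s r ha hs haβ hsβ
  refine ⟨fun u => M (0, u), hMc.comp (continuous_const.prodMk continuous_id), hMb,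
    fun u v => ⟨mem_W0_of_forall_test hMc (fun ε hε φ ψ => ?_) 0 u v, ?_⟩⟩
  · rw [eq_ofTest_regPowMul α hε φ ψ (M (ε, W0.ofTest 2 φ) (W0.ofTest 2 ψ)) ?_ ?_]
    · exact (W0.ofTest r (regPowMul α hε φ ψ)).2
    · filter_upwards [hM1 ε (W0.ofTest 2 φ) (W0.ofTest 2 ψ), fn_ofTest 2 φ,
        fn_ofTest 2 ψ] with x h1 h2 h3
      rw [h1, h2, h3]
    · filter_upwards [hM2 ε (W0.ofTest 2 φ) (W0.ofTest 2 ψ), fn_ofTest 2 φ, fn_ofTest 2 ψ,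
        gradL_ofTest 2 φ, gradL_ofTest 2 ψ] with x h1 h2 h3 h4 h5
      rw [h1, h2, h3, h4, h5]
  · filter_upwards [hM1 0 u v] with x h1
    rw [h1, regPow_zero_left]

/-! ### A function in `W₀^{1,r}(Ω)` determines its gradient -/

/-- Integration against a fixed function in the conjugate space is continuous on `L^r`. -/
theorem continuous_integral_bilin {X E F G : Type*} [MeasurableSpace X] {μ : Measure X}
    [NormedAddCommGroup E] [NormedSpace ℝ E] [NormedAddCommGroup F] [NormedSpace ℝ F]
    [NormedAddCommGroup G] [NormedSpace ℝ G] [CompleteSpace G] {r r' : ℝ≥0∞} [Fact (1 ≤ r)]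
    [Fact (1 ≤ r')] [ENNReal.HolderConjugate r' r] (B : E →L[ℝ] F →L[ℝ] G) {ψ : X → E}
    (hψ : MemLp ψ r' μ) : Continuous fun f : Lp F r μ => ∫ x, B (ψ x) (f x) ∂μ := by
  have : (fun f : Lp F r μ => ∫ x, B (ψ x) (f x) ∂μ) =
      fun f => B.lpPairing μ r' r (hψ.toLp ψ) f := by
    ext f
    rw [ContinuousLinearMap.lpPairing_eq_integral]
    refine integral_congr_ae ?_
    filter_upwards [hψ.coeFn_toLp] with x hx
    rw [hx]
  rw [this]
  exact (B.lpPairing μ r' r (hψ.toLp ψ)).continuous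

/-- Integration by parts in `W₀^{1,r}(Ω)` against smooth compactly supported functions. -/
theorem integral_smul_grad_eq_neg {n : ℕ} {Ω : Opens (EuclideanSpace ℝ (Fin n))} {r : ℝ≥0∞}
    [Fact (1 ≤ r)] {g : EuclideanSpace ℝ (Fin n) → ℝ} (hg : ContDiff ℝ ((⊤ : ℕ∞) : WithTop ℕ∞) g)
    (hgc : HasCompactSupport g) (e : EuclideanSpace ℝ (Fin n)) {w : FunGrad Ω r}
    (hw : w ∈ W0 Ω r) :
    ∫ x in (Ω : Set _), g x • w.2 x e = -∫ x in (Ω : Set _), fderiv ℝ g x e • w.1 x := by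
  have hconj : ENNReal.HolderConjugate (ENNReal.conjExponent r) r :=
    (ENNReal.HolderConjugate.conjExponent Fact.out).symm
  have hg' : Continuous fun x => fderiv ℝ g x e :=
    (hg.continuous_fderiv (by simp)).clm_apply continuous_const
  have hgc' : HasCompactSupport fun x => fderiv ℝ g x e :=
    (hgc.fderiv ℝ).comp_left (g := fun L : EuclideanSpace ℝ (Fin n) →L[ℝ] ℝ => L e) rfl
  have h1 : Continuous fun f : Lp (EuclideanSpace ℝ (Fin n) →L[ℝ] ℂ) r
      (volume.restrict (Ω : Set _)) => ∫ x in (Ω : Set _), g x • f x e :=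
    continuous_integral_bilin (r' := ENNReal.conjExponent r)
      -- The bilinear map `(c, L) ↦ c • L e`.
      ((ContinuousLinearMap.compL ℝ (EuclideanSpace ℝ (Fin n) →L[ℝ] ℂ) ℂ ℂ).flip
        (ContinuousLinearMap.apply ℝ ℂ e) ∘L ContinuousLinearMap.lsmul ℝ ℝ)
      ((hg.continuous.memLp_of_hasCompactSupport hgc).restrict _)
  have h2 : Continuous fun f : Lp ℂ r (volume.restrict (Ω : Set _)) =>
      ∫ x in (Ω : Set _), fderiv ℝ g x e • f x :=
    continuous_integral_bilin (r' := ENNReal.conjExponent r) (ContinuousLinearMap.lsmul ℝ ℝ)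
      ((hg'.memLp_of_hasCompactSupport hgc').restrict _)
  refine closure_minimal (s := (LinearMap.range (testPair Ω r) : Set (FunGrad Ω r)))
    (t := {w : FunGrad Ω r | ∫ x in (Ω : Set _), g x • w.2 x e =
      -∫ x in (Ω : Set _), fderiv ℝ g x e • w.1 x}) ?_
    (isClosed_eq (h1.comp continuous_snd) (h2.comp continuous_fst).neg) hw
  rintro _ ⟨φ, rfl⟩
  have e1 : ∫ x in (Ω : Set _), g x • (testPair Ω r φ).2 x e =
      ∫ x, g x • fderiv ℝ (fun y => φ y) x e := by
    refine Eq.trans ?_ (setIntegral_eq_integral_of_forall_compl_eq_zero (s := (Ω : Set _))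
      (f := fun x => g x • fderiv ℝ (fun y => φ y) x e) fun x hx => ?_)
    · refine integral_congr_ae ?_
      filter_upwards [grad_ofTest r φ] with x hx
      exact congrArg (fun L : EuclideanSpace ℝ (Fin n) →L[ℝ] ℂ => g x • L e) hx
    · have : fderiv ℝ (fun y => φ y) x = 0 :=
        Function.notMem_support.1 fun h => hx (support_fderiv_test_subset φ h)
      simp [this]
  have e2 : ∫ x in (Ω : Set _), fderiv ℝ g x e • (testPair Ω r φ).1 x =
      ∫ x, fderiv ℝ g x e • φ x := by
    refine Eq.trans ?_ (setIntegral_eq_integral_of_forall_compl_eq_zero (s := (Ω : Set _))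
      (f := fun x => fderiv ℝ g x e • φ x) fun x hx => ?_)
    · refine integral_congr_ae ?_
      filter_upwards [fn_ofTest r φ] with x hx
      exact congrArg (fderiv ℝ g x e • ·) hx
    · have : φ x = 0 :=
        Function.notMem_support.1 fun h => hx (φ.tsupport_subset (subset_tsupport _ h))
      simp [this]
  refine e1.trans (Eq.trans ?_ (congrArg Neg.neg e2.symm))
  have hφ' : Continuous fun x => fderiv ℝ (fun y => φ y) x e :=
    (φ.contDiff.continuous_fderiv (by simp)).clm_apply continuous_const
  refine integral_smul_fderiv_eq_neg_fderiv_smul_of_integrable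
    ((hg'.smul φ.continuous).integrable_of_hasCompactSupport φ.hasCompactSupport.smul_left)
    ((hg.continuous.smul hφ').integrable_of_hasCompactSupport hgc.smul_right)
    ((hg.continuous.smul φ.continuous).integrable_of_hasCompactSupport hgc.smul_right)
    (fun x _ => hg.differentiable (by simp) x) (fun x _ => φ.contDiff.differentiable (by simp) x)

/-- An element of `W₀^{1,r}(Ω)` is determined by its underlying function. -/
theorem W0.ext_fn {n : ℕ} {Ω : Opens (EuclideanSpace ℝ (Fin n))} {r : ℝ≥0∞} [Fact (1 ≤ r)]
    {v w : W0 Ω r} (h : W0.fn v =ᵐ[volume.restrict (Ω : Set _)] W0.fn w) : v = w := by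
  have h1 : v.1.1 = w.1.1 := Lp.ext h
  refine Subtype.ext (Prod.ext h1 ?_)
  rw [← sub_eq_zero]
  have hmem : v.1 - w.1 ∈ W0 Ω r := (v - w).2
  have hloc : LocallyIntegrableOn ((v.1 - w.1).2) (Ω : Set (EuclideanSpace ℝ (Fin n))) := by
    refine (locallyIntegrableOn_of_locallyIntegrable_restrict ?_)
    exact (Lp.memLp _).locallyIntegrable Fact.out
  -- Fundamental lemma of the calculus of variations, applied to the difference of the gradients;
  -- integration by parts moves the derivative onto `g`, leaving the difference of the functions,
  -- which is zero.
  have key := Ω.isOpen.ae_eq_zero_of_integral_contDiff_smul_eq_zero hloc fun g hg hgc hgΩ => by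
    have hint : IntegrableOn (fun x => g x • (v.1 - w.1).2 x) (Ω : Set _) :=
      ((Lp.memLp _).locallyIntegrable Fact.out).integrable_smul_left_of_hasCompactSupport
        hg.continuous hgc
    refine (setIntegral_eq_integral_of_forall_compl_eq_zero (s := (Ω : Set _))
      (f := fun x => g x • (v.1 - w.1).2 x) fun x hx => ?_).symm.trans ?_
    · rw [image_eq_zero_of_notMem_tsupport fun h => hx (hgΩ h)]
      exact zero_smul ℝ ((v.1 - w.1).2 x : EuclideanSpace ℝ (Fin n) →L[ℝ] ℂ)
    ext e
    rw [ContinuousLinearMap.integral_apply hint e]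
    refine (integral_smul_grad_eq_neg hg hgc e hmem).trans ?_
    have h0 : (v.1 - w.1).1 = 0 := sub_eq_zero.2 h1
    rw [zero_apply, neg_eq_zero]
    refine integral_eq_zero_of_ae ?_
    rw [h0]
    filter_upwards [Lp.coeFn_zero ℂ r
      (volume.restrict (Ω : Set (EuclideanSpace ℝ (Fin n))))] with x hx
    rw [hx]
    exact smul_zero _
  refine Lp.ext (Filter.EventuallyEq.trans ?_ (Lp.coeFn_zero _ _ _).symm)
  exact (ae_restrict_iff' Ω.isOpen.measurableSet).2 key

/-! ### Superposition in the time variable -/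

/-- A continuous map of growth order `α + 1` with `2 (α + 1) ≤ m` induces a bounded superposition
operator from `L^{(2,m)}(R₊; X)` into `L²(R₊; Y)`. The map is given by its graph `P`. -/
theorem exists_bounded_superposition {X Y : Type*} [NormedAddCommGroup X] [NormedSpace ℂ X]
    [NormedAddCommGroup Y] {m α : ℝ} [Fact (1 ≤ ENNReal.ofReal m)] (hα : 0 ≤ α)
    (hm : 2 * (α + 1) ≤ m) {P : X → Y → Prop} (hP : ∀ x y z, P x y → P x z → y = z)
    (hF : ∃ F : X → Y, Continuous F ∧ (∃ K : ℝ≥0, ∀ u, ‖F u‖ ≤ K * (‖u‖ ^ α * ‖u‖)) ∧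
      ∀ u, P u (F u)) :
    ∃ f : L2m X (ENNReal.ofReal m) → Lp Y 2 volPos,
      (∀ u G, f u = G ↔ ∀ᵐ t ∂volPos, P (L2m.fn u t) (G t)) ∧ IsBoundedOperator f := by
  obtain ⟨F, hF, ⟨K, hK⟩, hPF⟩ := hF
  have hm2 : 0 < m / 2 := by linarith
  -- As `1 ≤ α + 1 ≤ m / 2`, the power is dominated by `x` for `x ≤ 1` and by `x ^ (m / 2)` for `x ≥
  -- 1`. The `L²` norms of these two are controlled by the `L²` and `L^m` norms of `u`.
  have hpow (x : ℝ) (hx : 0 ≤ x) : x ^ α * x ≤ x + x ^ (m / 2) := by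
    rcases le_total x 1 with h | h
    · have h1 : x ^ α * x ≤ x := mul_le_of_le_one_left hx (Real.rpow_le_one hx h hα)
      linarith [Real.rpow_nonneg hx (m / 2)]
    · have h1 : x ^ α * x = x ^ (α + 1) := by rw [Real.rpow_add_one (by linarith)]
      have h2 : x ^ (α + 1) ≤ x ^ (m / 2) := Real.rpow_le_rpow_of_exponent_le h (by linarith)
      linarith
  have hm' : 2 * ENNReal.ofReal (m / 2) = ENNReal.ofReal m := by
    rw [← ENNReal.ofReal_ofNat, ← ENNReal.ofReal_mul (by norm_num)]
    congr 1
    ring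
  have hle (u : L2m X (ENNReal.ofReal m)) :
      eLpNorm (fun t => F (L2m.fn u t)) 2 volPos ≤
        ((K * (‖u‖₊ + ‖u‖₊ ^ (m / 2)) : ℝ≥0) : ℝ≥0∞) := by
    have h1 : eLpNorm (fun t => ‖L2m.fn u t‖ ^ (m / 2)) 2 volPos ≤ ‖u‖ₑ ^ (m / 2) := by
      -- `L2m.fn` is the `L²` representative; membership in `L2m` allows the switch to the `L^m`
      -- one.
      rw [eLpNorm_norm_rpow _ hm2, hm', eLpNorm_congr_ae (show L2m.fn u =ᵐ[volPos] u.1.2 from u.2),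
        ← Lp.enorm_def]
      gcongr
      exact enorm_le_iff_norm_le.2 (norm_snd_le u.1)
    have h2 : eLpNorm (fun t => ‖L2m.fn u t‖) 2 volPos ≤ ‖u‖ₑ := by
      rw [eLpNorm_norm]
      exact (Lp.enorm_def u.1.1).ge.trans (enorm_le_iff_norm_le.2 (norm_fst_le u.1))
    have hmeas : AEStronglyMeasurable (fun t => ‖L2m.fn u t‖) volPos :=
      (Lp.aestronglyMeasurable u.1.1).norm
    calc eLpNorm (fun t => F (L2m.fn u t)) 2 volPos
        ≤ K * eLpNorm (fun t => ‖L2m.fn u t‖ + ‖L2m.fn u t‖ ^ (m / 2)) 2 volPos := by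
          refine (eLpNorm_le_nnreal_smul_eLpNorm_of_ae_le_mul (c := K)
            (g := fun t => ‖L2m.fn u t‖ + ‖L2m.fn u t‖ ^ (m / 2))
            (Eventually.of_forall fun t => ?_) 2).trans (by simp [ENNReal.smul_def])
          rw [← NNReal.coe_le_coe, NNReal.coe_mul, coe_nnnorm, coe_nnnorm,
            Real.norm_of_nonneg (add_nonneg (norm_nonneg _) (by positivity))]
          exact (hK _).trans (mul_le_mul_of_nonneg_left (hpow _ (norm_nonneg _)) K.coe_nonneg)
      _ ≤ K * (‖u‖ₑ + ‖u‖ₑ ^ (m / 2)) := by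
          gcongr
          exact (eLpNorm_add_le hmeas (hmeas.aemeasurable.pow_const _).aestronglyMeasurable
            (by norm_num)).trans (add_le_add h2 h1)
      _ = _ := by
          rw [ENNReal.coe_mul, ENNReal.coe_add, ENNReal.coe_rpow_of_nonneg _ hm2.le]
          rfl
  have hmem (u : L2m X (ENNReal.ofReal m)) : MemLp (fun t => F (L2m.fn u t)) 2 volPos :=
    ⟨hF.comp_aestronglyMeasurable (Lp.aestronglyMeasurable u.1.1),
      (hle u).trans_lt ENNReal.coe_lt_top⟩
  refine ⟨fun u => (hmem u).toLp _, fun u G => ?_,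
    fun x => K * (x + x ^ (m / 2)), ?_, fun u => ?_⟩
  · rw [Lp.ext_iff]
    refine ⟨fun h => ?_, fun h => ?_⟩
    · filter_upwards [h, (hmem u).coeFn_toLp] with t h1 h2
      rw [← h1, h2]
      exact hPF _
    · filter_upwards [h, (hmem u).coeFn_toLp] with t h1 h2
      exact h2.trans (hP _ _ _ (hPF _) h1)
  · exact continuous_const.mul
      (continuous_id.add (NNReal.continuous_rpow_const hm2.le))
  · rw [← ENNReal.coe_le_coe, ← enorm_eq_nnnorm, Lp.enorm_toLp]
    exact hle u

/-! ### The product `q |u|^{p-2} u` in `W^{-1,2}(Ω)` -/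

/-- The distribution `q |u|^{p-2} u` is unique. -/
theorem IsProduct.unique {n : ℕ} {Ω : Opens (EuclideanSpace ℝ (Fin n))} {s : ℝ≥0∞}
    {q : WNeg Ω s} {p : ℝ} {u : W0 Ω 2} {F G : WNeg Ω 2} (hF : IsProduct q p u F)
    (hG : IsProduct q p u G) : F = G := by
  refine DFunLike.coe_injective
    ((denseRange_ofTest Ω (ENNReal.conjExponent 2)).equalizer F.continuous G.continuous ?_)
  funext φ
  obtain ⟨v, hv, hFv⟩ := hF φ
  obtain ⟨w, hw, hGw⟩ := hG φ
  have hvw : v = w := W0.ext_fn <| by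
    filter_upwards [hv, hw] with x h1 h2
    exact h1.trans h2.symm
  exact hFv.trans (hvw ▸ hGw.symm)

/-- Composition of a functional on a subspace with operators into this subspace. -/
theorem exists_dual_comp {U V E : Type*} [TopologicalSpace U] [NormedAddCommGroup V]
    [NormedSpace ℂ V] [NormedAddCommGroup E] [NormedSpace ℂ E] (S : Submodule ℂ E)
    (q : S →L[ℂ] ℂ) {M : U → V →L[ℂ] E} (hM : Continuous M) {b : U → ℝ}
    (hb : ∃ K : ℝ≥0, ∀ u, ‖M u‖ ≤ K * b u) (hS : ∀ u v, M u v ∈ S) :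
    ∃ F : U → V →L[ℂ] ℂ, Continuous F ∧ (∃ K : ℝ≥0, ∀ u, ‖F u‖ ≤ K * b u) ∧
      ∀ u v, F u v = q ⟨M u v, hS u v⟩ := by
  -- Hahn–Banach: with `q` extended to all of `E`, continuity in `u` is that of composition of
  -- operators, with no restriction of codomain.
  obtain ⟨Q, hQ, -⟩ := exists_extension_norm_eq S q
  obtain ⟨K, hK⟩ := hb
  refine ⟨fun u => Q.comp (M u), continuous_const.clm_comp hM, ⟨‖Q‖₊ * K, fun u => ?_⟩,
    fun u v => hQ ⟨M u v, hS u v⟩⟩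
  refine (Q.opNorm_comp_le (M u)).trans ?_
  rw [NNReal.coe_mul, mul_assoc]
  exact mul_le_mul_of_nonneg_left (hK u) (norm_nonneg Q)

/-- A functional on `W₀^{1,r}(Ω)` multiplied by `|u|^α u` is a functional on `W₀^{1,2}(Ω)`. -/
theorem exists_dual_powMul_operator {n : ℕ} (hn : 3 ≤ n) (Ω : Opens (EuclideanSpace ℝ (Fin n)))
    (hΩ : Bornology.IsBounded (Ω : Set (EuclideanSpace ℝ (Fin n)))) {α : ℝ} (hα : 0 ≤ α)
    (a s r : ℝ≥0∞) [Fact (1 ≤ (sobolevExponent n : ℝ≥0∞))] [Fact (1 ≤ a)] [Fact (1 ≤ s)]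
    [Fact (1 ≤ r)] (ha : a ≠ ∞) (hs : s ≠ ∞)
    (haβ : a⁻¹ = ENNReal.ofReal α * (sobolevExponent n : ℝ≥0∞)⁻¹ + (sobolevExponent n : ℝ≥0∞)⁻¹)
    (hsβ : s⁻¹ = ENNReal.ofReal α * (sobolevExponent n : ℝ≥0∞)⁻¹ + 2⁻¹)
    [ENNReal.HolderTriple a 2 r] [ENNReal.HolderTriple s (sobolevExponent n) r]
    (q : W0 Ω r →L[ℂ] ℂ) {t : ℝ≥0∞} [Fact (1 ≤ t)] (ht : t = 2) :
    ∃ F : W0 Ω 2 → W0 Ω t →L[ℂ] ℂ, Continuous F ∧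
      (∃ K : ℝ≥0, ∀ u, ‖F u‖ ≤ K * (‖u‖ ^ α * ‖u‖)) ∧
      ∀ u (φ : 𝓓(Ω, ℂ)), ∃ w : W0 Ω r,
        (∀ᵐ x ∂(volume.restrict (Ω : Set (EuclideanSpace ℝ (Fin n)))),
          W0.fn w x = ((‖W0.fn u x‖ ^ α : ℝ) : ℂ) * W0.fn u x * φ x) ∧
        F u (W0.ofTest t φ) = q w := by
  -- The variable `t` stands for the conjugate exponent of `2`, equal to `2` only propositionally.
  subst ht
  obtain ⟨M, hMc, hK, hM⟩ := exists_powMul_operator hn Ω hΩ hα a s r ha hs haβ hsβ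
  obtain ⟨F, hFc, hFK, hF⟩ := exists_dual_comp (W0 Ω r) q hMc hK fun u v => (hM u v).1
  refine ⟨F, hFc, hFK, fun u φ =>
    ⟨⟨M u (W0.ofTest 2 φ), (hM u _).1⟩, ?_, hF u (W0.ofTest 2 φ)⟩⟩
  filter_upwards [(hM u (W0.ofTest 2 φ)).2, fn_ofTest 2 φ] with x h1 h2
  exact h1.trans (congrArg (_ * ·) h2)

/-- Existence of the product `q |u|^{p-2} u` in `W^{-1,2}(Ω)`, continuously in `u`. -/
theorem exists_isProduct_operator {n : ℕ} (hn : 3 ≤ n) (Ω : Opens (EuclideanSpace ℝ (Fin n)))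
    (hΩ : Bornology.IsBounded (Ω : Set (EuclideanSpace ℝ (Fin n)))) {p p₀ : ℝ} (hp : 2 ≤ p)
    (hp' : p < 2 * ((n : ℝ) - 1) / ((n : ℝ) - 2))
    (hp₀ : p₀ = 2 * (n : ℝ) / (2 * ((n : ℝ) - 1) - p * ((n : ℝ) - 2)))
    (q : WNeg Ω (ENNReal.ofReal p₀)) :
    ∃ F : W0 Ω 2 → WNeg Ω 2, Continuous F ∧
      (∃ K : ℝ≥0, ∀ u, ‖F u‖ ≤ K * (‖u‖ ^ (p - 2) * ‖u‖)) ∧ ∀ u, IsProduct q p u (F u) := by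
  have h3 : (3 : ℝ) ≤ n := by exact_mod_cast hn
  have hn2 : (0 : ℝ) < n - 2 := by linarith
  have hn0 : (0 : ℝ) < n := by linarith
  rw [lt_div_iff₀ hn2] at hp'
  have hα : 0 ≤ p - 2 := by linarith
  -- `κ` is the reciprocal of the Sobolev exponent; all Hölder relations become linear in `κ`.
  obtain ⟨κ, hκ⟩ : ∃ κ : ℝ, κ = (n - 2) / (2 * n) := ⟨_, rfl⟩
  have hκ0 : 0 < κ := hκ ▸ by positivity
  -- This is exactly the subcriticality `hp'`; it makes `p₀` positive and keeps `1/a` and `1/s` at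
  -- most `1`.
  have hκp : (p - 1) * κ < 1 / 2 := by
    rw [hκ, mul_div_assoc', div_lt_iff₀ (by positivity)]
    nlinarith
  have hκn : κ * (2 * n) = n - 2 := by
    rw [hκ]
    field_simp
  have hακ : 0 ≤ (p - 2) * κ := by positivity
  have hp₀inv : p₀⁻¹ = 1 / 2 - (p - 1) * κ := by
    rw [hp₀, inv_div, hκ]
    field_simp
    ring
  have hp₀pos : 0 < p₀ := inv_pos.1 (hp₀inv ▸ by linarith)
  have h2inv : (2 : ℝ≥0∞)⁻¹ = ENNReal.ofReal (1 / 2) := by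
    rw [one_div, ENNReal.ofReal_inv_of_pos two_pos, ENNReal.ofReal_ofNat]
  have hβ : (sobolevExponent n : ℝ≥0∞)⁻¹ = ENNReal.ofReal κ := by
    rw [← ENNReal.ofReal_coe_nnreal, coe_sobolevExponent hn,
      ← ENNReal.ofReal_inv_of_pos (by positivity), inv_div, hκ]
  have hr : (ENNReal.conjExponent (ENNReal.ofReal p₀))⁻¹ =
      ENNReal.ofReal ((p - 1) * κ + 1 / 2) := by
    have hone : 1 ≤ ENNReal.ofReal p₀ := by
      rw [ENNReal.one_le_ofReal, ← inv_le_one₀ hp₀pos]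
      nlinarith
    have := ENNReal.HolderConjugate.conjExponent hone
    rw [← ENNReal.HolderConjugate.one_sub_inv (ENNReal.ofReal p₀),
      ← ENNReal.ofReal_inv_of_pos hp₀pos, hp₀inv, ← ENNReal.ofReal_one,
      ← ENNReal.ofReal_sub _ (by linarith)]
    congr 1
    ring
  have hinv {x : ℝ} (hx : x ≤ 1) : Fact (1 ≤ (ENNReal.ofReal x)⁻¹) :=
    ⟨ENNReal.one_le_inv.2 (ENNReal.ofReal_le_one.2 hx)⟩
  have : Fact (1 ≤ (sobolevExponent n : ℝ≥0∞)) :=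
    ⟨by rw [← ENNReal.inv_le_one, hβ, ENNReal.ofReal_le_one]; nlinarith⟩
  have : Fact (1 ≤ (ENNReal.ofReal ((p - 1) * κ))⁻¹) := hinv (by linarith)
  have : Fact (1 ≤ (ENNReal.ofReal ((p - 2) * κ + 1 / 2))⁻¹) := hinv (by linarith)
  have : ENNReal.HolderTriple (ENNReal.ofReal ((p - 1) * κ))⁻¹ 2
      (ENNReal.conjExponent (ENNReal.ofReal p₀)) := ⟨by
    rw [hr, inv_inv, h2inv, ← ENNReal.ofReal_add (by nlinarith) (by norm_num)]⟩
  have : ENNReal.HolderTriple (ENNReal.ofReal ((p - 2) * κ + 1 / 2))⁻¹ (sobolevExponent n)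
      (ENNReal.conjExponent (ENNReal.ofReal p₀)) := ⟨by
    rw [hr, inv_inv, hβ, ← ENNReal.ofReal_add (by linarith) hκ0.le]
    congr 1
    ring⟩
  refine exists_dual_powMul_operator hn Ω hΩ hα (ENNReal.ofReal ((p - 1) * κ))⁻¹
    (ENNReal.ofReal ((p - 2) * κ + 1 / 2))⁻¹ _ ?_ ?_ ?_ ?_ q ?_
  · simpa using mul_pos (by linarith : 0 < p - 1) hκ0
  · rw [ENNReal.inv_ne_top, ENNReal.ofReal_ne_zero_iff]
    linarith
  · rw [inv_inv, hβ, ← ENNReal.ofReal_mul hα, ← ENNReal.ofReal_add hακ hκ0.le]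
    congr 1
    ring
  · rw [inv_inv, hβ, h2inv, ← ENNReal.ofReal_mul hα, ← ENNReal.ofReal_add hακ (by norm_num)]
  · rw [ENNReal.conjExponent, ENNReal.sub_eq_of_eq_add ENNReal.one_ne_top one_add_one_eq_two.symm,
      inv_one, one_add_one_eq_two]

end SobolevProduct

end

theorem proposition1 (n : ℕ) (hn : 3 ≤ n)
    (Ω : TopologicalSpace.Opens (EuclideanSpace ℝ (Fin n)))
    (hΩ : Bornology.IsBounded (Ω : Set (EuclideanSpace ℝ (Fin n))))
    (p p₀ m : ℝ) (hp : 2 ≤ p) (hp' : p < 2 * ((n : ℝ) - 1) / ((n : ℝ) - 2))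
    (hp₀ : p₀ = 2 * (n : ℝ) / (2 * ((n : ℝ) - 1) - p * ((n : ℝ) - 2)))
    [Fact (1 ≤ ENNReal.ofReal m)] (hm : 2 * (n : ℝ) / ((n : ℝ) - 2) ≤ m)
    (q : SobolevProduct.WNeg Ω (ENNReal.ofReal p₀)) :
    ∃ f : SobolevProduct.L2m (SobolevProduct.W0 Ω 2) (ENNReal.ofReal m) →
        MeasureTheory.Lp (SobolevProduct.WNeg Ω 2) 2 SobolevProduct.volPos,
      (∀ u F, f u = F ↔
        ∀ᵐ t ∂SobolevProduct.volPos, SobolevProduct.IsProduct q p (SobolevProduct.L2m.fn u t) (F t)) ∧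
      SobolevProduct.IsBoundedOperator f := by
  have h3 : (3 : ℝ) ≤ n := by exact_mod_cast hn
  -- Subcriticality means `p - 1 < n / (n - 2)`, so `2 (p - 1)` stays below the Sobolev exponent,
  -- hence below `m`.
  have hm' : 2 * (p - 2 + 1) ≤ m := by
    refine le_trans ?_ hm
    rw [lt_div_iff₀ (by linarith)] at hp'
    rw [le_div_iff₀ (by linarith)]
    linarith
  exact SobolevProduct.exists_bounded_superposition (P := SobolevProduct.IsProduct q p)
    (by linarith) hm' (fun _ _ _ => SobolevProduct.IsProduct.unique)
    (SobolevProduct.exists_isProduct_operator hn Ω hΩ hp hp' hp₀ q)
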